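/- A directed 2-complex $\mathcal K$ is a directed graph together with a set $\mathbf F^+$ of positive 2-cells, each $f\in\mathbf F^+$ having a nonempty top path $\lceil f\rceil$ and a nonempty bottom path $\lfloor f\rfloor$ (directed paths with common initial and common terminal vertices). A 1-path in $\mathcal K$ is a (possibly empty) directed path. Two 1-paths are homotopic if one is obtained from the other by finitely many replacements of a subpath $\lceil f\rceil$ by $\lfloor f\rfloor$ or vice versa. The Squier complex $\mathrm{Sq}(\mathcal K)$ has the 1-paths as vertices, the triples $x=(p,f,q)$ with $p\lceil f\rceil q$ a 1-path and $f\in\mathbf F^+$ as positive edges, from $p\lceil f\rceil q$ to $p\lfloor f\rfloor q$, and for every 1-path $p\lceil f\rceil q\lceil g\rceil r$ with $f,g\in\mathbf F^+$ a square 2-cell whose two sides are $(p,f,q\lceil g\rceil r)(p\lfloor f\rfloor q,g,r)$ and $(p\lceil f\rceil q,g,r)(p,f,q\lfloor g\rfloor r)$. The diagram group $\mathcal D(\mathcal K,w)$ is the fundamental group $\pi_1(\mathrm{Sq}(\mathcal K),w)$. Let $\mathbf E$ be the set of edges of $\mathcal K$ and $\{G_e\mid e\in\mathbf E\}$ a family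 of groups; for a 1-path $s=e_1\cdots e_n$ put $G(s)=G_{e_1}\times\cdots\times G_{e_n}$. The diagram product of this family over $\mathcal K$ with base $w$ is the fundamental group, with base $w$, of the complex of groups on (the 2-skeleton of) $\mathrm{Sq}(\mathcal K)$ in which the vertex $s$ carries $G(s)$, the edge $(p,f,q)$ carries $G(p)\times G(q)$, embedded coordinate-wise in $G(p\lceil f\rceil q)$ and in $G(p\lfloor f\rfloor q)$, and the 2-cells carry trivial groups. The independence graph $\Gamma(\mathcal K,w)$ has as vertices the edges of $\mathcal K$ that belong to 1-paths homotopic to $w$; two different such edges are adjacent if and only if some 1-path homotopic to $w$ contains both. The graph product of groups $G_v$ ($v\in V$) over a graph with vertex set $V$ is the quotient of the free product $*_{v\in V}G_v$ by the normal subgroup generated by all commutators $[g,h]$ with $g\in G_s$, $h\in G_t$, where $s,t$ are adjacent. **Lemma.** Let $\mathcal K$ be a directed 2-complex and $w$ a nonempty 1-path in $\mathcal K$. Suppose that - (T2) every two 1-paths in $\mathcal K$ with the same endpoints are homotopic, and - (T3) the diagram group $\mathcal D(\mathcal K,w)$ is trivial. Then, for every family of groups $\{G_e\mid e\in\mathbf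 E\}$, the diagram product of the family over $\mathcal K$ with base $w$ is isomorphic to the graph product over $\Gamma(\mathcal K,w)$ of the groups $G_e$, $e$ a vertex of $\Gamma(\mathcal K,w)$. -/

import Mathlib

open CategoryTheory

universe u v w x

/-! ### Square complexes, complexes of groups over them, fundamental groups -/

/-- The 2-cells of a square complex whose vertices and (positively oriented) edges form the
quiver `X`: `S e₁ e₂ e₁' e₂'` says that there is a 2-cell with boundary
`e₁ e₂ (e₁' e₂')⁻¹`. -/
def SquareCells (X : Type u) [Quiver.{v} X] :=
  ∀ ⦃s t t' z : X⦄, (s ⟶ t) → (t ⟶ z) → (s ⟶ t') → (t' ⟶ z) → Prop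

namespace SquareCells

variable {X : Type u} [Quiver.{v} X] (S : SquareCells X)

/-- The two sides of every 2-cell are identified. -/
inductive Rel : HomRel (Quiver.FreeGroupoid X)
  | square {a b b' c : X} (e₁ : a ⟶ b) (e₂ : b ⟶ c) (e₁' : a ⟶ b') (e₂' : b' ⟶ c)
      (h : S e₁ e₂ e₁' e₂') :
      Rel ((Quiver.FreeGroupoid.of X).map e₁ ≫ (Quiver.FreeGroupoid.of X).map e₂)
        ((Quiver.FreeGroupoid.of X).map e₁' ≫ (Quiver.FreeGroupoid.of X).map e₂')

/-- The edge-path groupoid (fundamental groupoid) of a square complex. -/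
abbrev Groupoid := CategoryTheory.Quotient S.Rel

/-- A vertex of the complex as an object of its fundamental groupoid. -/
def obj (a : X) : S.Groupoid := ⟨(Quiver.FreeGroupoid.of X).obj a⟩

/-- The fundamental group: homotopy classes of closed edge paths at `a`. -/
abbrev Pi1 (a : X) := S.obj a ⟶ S.obj a

end SquareCells

/-- A complex of groups over a square complex, with trivial groups on the 2-cells (hence without
twisting elements): a group on every vertex, a group on every edge, and embeddings of the edge
groups in the groups of the initial and the terminal vertex. -/
structure ComplexOfGroups (X : Type u) [Quiver.{v} X] where
  /-- the 2-cells of the underlying complex -/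
  cells : SquareCells X
  /-- the vertex groups -/
  VertexGroup : X → Type w
  [vertexGroup : ∀ a, Group (VertexGroup a)]
  /-- the edge groups -/
  EdgeGroup : ∀ {a b : X}, (a ⟶ b) → Type w
  [edgeGroup : ∀ {a b : X} (e : a ⟶ b), Group (EdgeGroup e)]
  /-- the embedding in the group of the initial vertex -/
  ι : ∀ {a b : X} (e : a ⟶ b), EdgeGroup e →* VertexGroup a
  /-- the embedding in the group of the terminal vertex -/
  τ : ∀ {a b : X} (e : a ⟶ b), EdgeGroup e →* VertexGroup b
  ι_injective : ∀ {a b : X} (e : a ⟶ b), Function.Injective (ι e)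
  τ_injective : ∀ {a b : X} (e : a ⟶ b), Function.Injective (τ e)

attribute [instance] ComplexOfGroups.vertexGroup ComplexOfGroups.edgeGroup

namespace ComplexOfGroups

variable {X : Type u} [Quiver.{v} X] (C : ComplexOfGroups.{u, v, w} X)

/-- The vertices of `X`, as the vertices of the quiver of generators of the fundamental groupoid
of the complex of groups. -/
def Vertex (_ : ComplexOfGroups.{u, v, w} X) : Type u := X

/-- The generators of the fundamental groupoid: the elements of the vertex groups, which are
loops, and the edges. -/
inductive Gen : X → X → Type (max u v w)
  | elt {a : X} (g : C.VertexGroup a) : Gen a a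
  | edge {a b : X} (e : a ⟶ b) : Gen a b

instance : Quiver C.Vertex := ⟨C.Gen⟩

/-- An element of a vertex group, in the free groupoid on the generators. -/
def elt {a : X} (g : C.VertexGroup a) :
    (Quiver.FreeGroupoid.of C.Vertex).obj a ⟶ (Quiver.FreeGroupoid.of C.Vertex).obj a :=
  (Quiver.FreeGroupoid.of C.Vertex).map (X := a) (Y := a) (Gen.elt g)

/-- An edge, in the free groupoid on the generators. -/
def edge {a b : X} (e : a ⟶ b) :
    (Quiver.FreeGroupoid.of C.Vertex).obj a ⟶ (Quiver.FreeGroupoid.of C.Vertex).obj b :=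
  (Quiver.FreeGroupoid.of C.Vertex).map (X := a) (Y := b) (Gen.edge e)

/-- The relations of the fundamental groupoid: those of the vertex groups, `e⁻¹ ι(k) e = τ(k)` for
`k` in the group of the edge `e`, and those given by the 2-cells. -/
inductive Rel : HomRel (Quiver.FreeGroupoid C.Vertex)
  | mul {a : X} (g h : C.VertexGroup a) : Rel (C.elt g ≫ C.elt h) (C.elt (g * h))
  | edge {a b : X} (e : a ⟶ b) (k : C.EdgeGroup e) :
      Rel (C.elt (C.ι e k) ≫ C.edge e) (C.edge e ≫ C.elt (C.τ e k))
  | square {a b b' c : X} (e₁ : a ⟶ b) (e₂ : b ⟶ c) (e₁' : a ⟶ b') (e₂' : b' ⟶ c)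
      (h : C.cells e₁ e₂ e₁' e₂') :
      Rel (C.edge e₁ ≫ C.edge e₂) (C.edge e₁' ≫ C.edge e₂')

/-- The fundamental groupoid of a complex of groups. -/
abbrev Groupoid := CategoryTheory.Quotient C.Rel

/-- A vertex of the complex as an object of the fundamental groupoid. -/
def obj (a : X) : C.Groupoid := ⟨(Quiver.FreeGroupoid.of C.Vertex).obj a⟩

/-- The fundamental group of the complex of groups with base vertex `a`. -/
abbrev Pi1 (a : X) := C.obj a ⟶ C.obj a

end ComplexOfGroups

/-! ### Directed 2-complexes -/

/-- A directed 2-complex with underlying directed graph `V`. A 1-path is a (possibly empty)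
directed path in `V`. Only the positive 2-cells are recorded; the inverse of a 2-cell `f` has the
top and the bottom path of `f` exchanged. -/
structure DirectedTwoComplex (V : Type u) [Quiver.{v} V] where
  /-- the positive 2-cells -/
  Cell : Type w
  /-- initial vertex -/
  src : Cell → V
  /-- terminal vertex -/
  tgt : Cell → V
  /-- top path -/
  top : ∀ f, Quiver.Path (src f) (tgt f)
  /-- bottom path -/
  bot : ∀ f, Quiver.Path (src f) (tgt f)
  top_nonempty : ∀ f, (top f).length ≠ 0
  bot_nonempty : ∀ f, (bot f).length ≠ 0

namespace DirectedTwoComplex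

variable {V : Type u} [Quiver.{v} V]

/-- The edges of a directed 2-complex. -/
abbrev Edge (_ : DirectedTwoComplex.{u, v, w} V) := Σ a b : V, (a ⟶ b)

variable (K : DirectedTwoComplex.{u, v, w} V)

/-- The vertices of the part of the Squier complex `Sq(K)` that consists of the 1-paths from `a`
to `b`. As 2-cells preserve the endpoints of a 1-path, it is a union of connected components of
`Sq(K)`. -/
def Squier (_ : DirectedTwoComplex.{u, v, w} V) (a b : V) := Quiver.Path a b

/-- The positive edges `(p, f, q)` of the Squier complex from `s` to `t`: `f` is a positive 2-cell,
`s = p ⌈f⌉ q` and `t = p ⌊f⌋ q`. -/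
structure SquierEdge {a b : V} (s t : Quiver.Path a b) where
  /-- the 2-cell -/
  cell : K.Cell
  /-- the part before the 2-cell -/
  left : Quiver.Path a (K.src cell)
  /-- the part after the 2-cell -/
  right : Quiver.Path (K.tgt cell) b
  source_eq : (left.comp (K.top cell)).comp right = s
  target_eq : (left.comp (K.bot cell)).comp right = t

instance (a b : V) : Quiver (K.Squier a b) := ⟨fun s t => K.SquierEdge s t⟩

/-- The 2-cells of the Squier complex: for 1-paths `p`, `q`, `r` and positive 2-cells `f`, `g`, a
square whose sides apply `f` and `g` to `p ⌈f⌉ q ⌈g⌉ r` in the two possible orders. -/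
inductive SquierSquare (a b : V) : SquareCells (K.Squier a b)
  | mk (f g : K.Cell) (p : Quiver.Path a (K.src f)) (q : Quiver.Path (K.tgt f) (K.src g))
      (r : Quiver.Path (K.tgt g) b) :
      SquierSquare a b
        (s := ((((p.comp (K.top f)).comp q).comp (K.top g)).comp r :))
        (t := ((((p.comp (K.bot f)).comp q).comp (K.top g)).comp r :))
        (t' := ((((p.comp (K.top f)).comp q).comp (K.bot g)).comp r :))
        (z := ((((p.comp (K.bot f)).comp q).comp (K.bot g)).comp r :))
        (SquierEdge.mk f p ((q.comp (K.top g)).comp r)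
          (by simp only [Quiver.Path.comp_assoc]) (by simp only [Quiver.Path.comp_assoc]))
        (SquierEdge.mk g ((p.comp (K.bot f)).comp q) r rfl rfl)
        (SquierEdge.mk g ((p.comp (K.top f)).comp q) r rfl rfl)
        (SquierEdge.mk f p ((q.comp (K.bot g)).comp r)
          (by simp only [Quiver.Path.comp_assoc]) (by simp only [Quiver.Path.comp_assoc]))

/-- The diagram group `D(K, s)`: the fundamental group of the Squier complex with base `s`. -/
abbrev DiagramGroup {a b : V} (s : Quiver.Path a b) :=
  SquareCells.Pi1 (X := K.Squier a b) (K.SquierSquare a b) s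

/-- Homotopy of 1-paths: one can be obtained from the other by finitely many replacements of
`⌈f⌉` by `⌊f⌋` or of `⌊f⌋` by `⌈f⌉`. -/
def Homotopic {a b : V} (s t : Quiver.Path a b) : Prop :=
  Relation.EqvGen (fun s t : Quiver.Path a b => Nonempty (K.SquierEdge s t)) s t

/-- The edge `e` belongs to the 1-path `s`. -/
def Occurs {a b : V} (e : K.Edge) (s : Quiver.Path a b) : Prop :=
  ∃ (p : Quiver.Path a e.1) (q : Quiver.Path e.2.1 b), s = (p.cons e.2.2).comp q

/-- The vertices of the independence graph: the edges that belong to 1-paths homotopic to `s`. -/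
abbrev IndependenceVertex {a b : V} (s : Quiver.Path a b) :=
  {e : K.Edge // ∃ t : Quiver.Path a b, K.Homotopic s t ∧ K.Occurs e t}

/-- The independence graph `Γ(K, s)`: two different edges are adjacent if some 1-path homotopic to
`s` contains both. -/
def independenceGraph {a b : V} (s : Quiver.Path a b) : SimpleGraph (K.IndependenceVertex s) where
  Adj e₁ e₂ := e₁ ≠ e₂ ∧
    ∃ t : Quiver.Path a b, K.Homotopic s t ∧ K.Occurs e₁.1 t ∧ K.Occurs e₂.1 t
  symm := ⟨fun _ _ h => ⟨h.1.symm, h.2.imp fun _ ht => ⟨ht.1, ht.2.2, ht.2.1⟩⟩⟩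
  loopless := ⟨fun _ h => h.1 rfl⟩

/-! ### Diagram products -/

variable (G : K.Edge → Type x)

/-- The group `G(s)` for a 1-path `s = e₁ ⋯ eₙ`: the direct product `G_{e₁} × ⋯ × G_{eₙ}`. -/
def PathGroup {a : V} : ∀ {b : V}, Quiver.Path a b → Type x
  | _, .nil => PUnit
  | _, .cons p e => PathGroup p × G ⟨_, _, e⟩

variable [∀ e, Group (G e)]

instance instGroupPathGroup {a : V} : ∀ {b : V} (s : Quiver.Path a b), Group (K.PathGroup G s)
  | _, .nil => inferInstanceAs (Group PUnit)
  | _, .cons p e =>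
    letI := instGroupPathGroup p
    inferInstanceAs (Group (K.PathGroup G p × G ⟨_, _, e⟩))

/-- The isomorphism of `G(p) × G(q)` with `G(pq)` given by concatenation of tuples. -/
def concat {a b : V} (p : Quiver.Path a b) : ∀ {c : V} (q : Quiver.Path b c),
    K.PathGroup G p × K.PathGroup G q ≃* K.PathGroup G (p.comp q)
  | _, .nil =>
    { toFun := fun g => g.1
      invFun := fun g => (g, PUnit.unit)
      left_inv := fun _ => rfl
      right_inv := fun _ => rfl
      map_mul' := fun _ _ => rfl }
  | _, .cons q e =>
    { toFun := fun g => (concat p q (g.1, g.2.1), g.2.2)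
      invFun := fun g => (((concat p q).symm g.1).1, (((concat p q).symm g.1).2, g.2))
      left_inv := fun g => by
        rcases g with ⟨g, h, k⟩
        simp
      right_inv := fun g => by
        rcases g with ⟨g, k⟩
        exact Prod.ext ((concat p q).apply_symm_apply g) rfl
      map_mul' := fun g h => Prod.ext (map_mul (concat p q) (g.1, g.2.1) (h.1, h.2.1)) rfl }

/-- The identity map of `G(s) = G(t)` for equal 1-paths `s = t`. -/
def pathGroupCongr {a b : V} {s t : Quiver.Path a b} (h : s = t) :
    K.PathGroup G s ≃* K.PathGroup G t :=
  h ▸ MulEquiv.refl _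

/-- The coordinate-wise embedding of `G(p) × G(q)` in `G(prq) = G(p) × G(r) × G(q)`. -/
def embed {a b c d : V} (p : Quiver.Path a b) (r : Quiver.Path b c) (q : Quiver.Path c d) :
    K.PathGroup G p × K.PathGroup G q →* K.PathGroup G ((p.comp r).comp q) where
  toFun g := K.concat G (p.comp r) q (K.concat G p r (g.1, 1), g.2)
  map_one' := by
    change K.concat G (p.comp r) q (K.concat G p r 1, 1) = 1
    rw [map_one]
    exact map_one _
  map_mul' g h := by
    have h1 : K.concat G p r (g.1 * h.1, 1) =
        K.concat G p r (g.1, 1) * K.concat G p r (h.1, 1) := by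
      rw [← map_mul, Prod.mk_mul_mk, one_mul]
    rw [Prod.fst_mul, Prod.snd_mul, h1, ← Prod.mk_mul_mk]
    exact map_mul (K.concat G (p.comp r) q) _ _

theorem embed_injective {a b c d : V} (p : Quiver.Path a b) (r : Quiver.Path b c)
    (q : Quiver.Path c d) : Function.Injective (K.embed G p r q) := by
  intro g h hgh
  have h1 := Prod.ext_iff.1 ((K.concat G (p.comp r) q).injective hgh)
  have h2 := Prod.ext_iff.1 ((K.concat G p r).injective h1.1)
  exact Prod.ext h2.1 h1.2

/-- The embedding `ι` of `G(p) × G(q)` in `G(s)` for an edge `(p, f, q)` from `s = p ⌈f⌉ q`. -/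
def edgeι {a b : V} {s t : Quiver.Path a b} (e : K.SquierEdge s t) :
    K.PathGroup G e.left × K.PathGroup G e.right →* K.PathGroup G s :=
  (K.pathGroupCongr G e.source_eq).toMonoidHom.comp (K.embed G e.left (K.top e.cell) e.right)

/-- The embedding `τ` of `G(p) × G(q)` in `G(t)` for an edge `(p, f, q)` to `t = p ⌊f⌋ q`. -/
def edgeτ {a b : V} {s t : Quiver.Path a b} (e : K.SquierEdge s t) :
    K.PathGroup G e.left × K.PathGroup G e.right →* K.PathGroup G t :=
  (K.pathGroupCongr G e.target_eq).toMonoidHom.comp (K.embed G e.left (K.bot e.cell) e.right)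

/-- The complex of groups on the Squier complex: the group of the vertex `s` is `G(s)`, the group
of the edge `(p, f, q)` is `G(p) × G(q)`, embedded coordinate-wise in
`G(p ⌈f⌉ q)` and `G(p ⌊f⌋ q)`, and the groups of the 2-cells are trivial. -/
def squierComplexOfGroups (a b : V) : ComplexOfGroups (K.Squier a b) where
  cells := K.SquierSquare a b
  VertexGroup := fun s : Quiver.Path a b => K.PathGroup G s
  vertexGroup := fun s : Quiver.Path a b => K.instGroupPathGroup G s
  EdgeGroup := fun {s t : Quiver.Path a b} (e : K.SquierEdge s t) =>
    K.PathGroup G e.left × K.PathGroup G e.right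
  edgeGroup := fun {s t : Quiver.Path a b} (e : K.SquierEdge s t) =>
    inferInstanceAs (Group (K.PathGroup G e.left × K.PathGroup G e.right))
  ι := fun {s t : Quiver.Path a b} (e : K.SquierEdge s t) => K.edgeι G e
  τ := fun {s t : Quiver.Path a b} (e : K.SquierEdge s t) => K.edgeτ G e
  ι_injective := fun {s t : Quiver.Path a b} (e : K.SquierEdge s t) =>
    (K.pathGroupCongr G e.source_eq).injective.comp (K.embed_injective G _ _ _)
  τ_injective := fun {s t : Quiver.Path a b} (e : K.SquierEdge s t) =>
    (K.pathGroupCongr G e.target_eq).injective.comp (K.embed_injective G _ _ _)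

/-- The diagram product of the groups `G e` over `K` with base `s`. -/
abbrev DiagramProduct {a b : V} (s : Quiver.Path a b) :=
  (K.squierComplexOfGroups G a b).Pi1 s

end DirectedTwoComplex

/-! ### Graph products -/

/-- The defining relators of a graph product: the commutators of elements of the groups of
adjacent vertices. -/
def graphProductRelators {I : Type u} (Γ : SimpleGraph I) (G : I → Type v) [∀ i, Group (G i)] :
    Set (Monoid.CoprodI G) :=
  {c | ∃ s t : I, Γ.Adj s t ∧ ∃ (g : G s) (h : G t),
    c = (Monoid.CoprodI.of g)⁻¹ * (Monoid.CoprodI.of h)⁻¹ * Monoid.CoprodI.of g *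
      Monoid.CoprodI.of h}

/-- The graph product of the groups `G i` over the graph `Γ`. -/
abbrev GraphProduct {I : Type u} (Γ : SimpleGraph I) (G : I → Type v) [∀ i, Group (G i)] :=
  Monoid.CoprodI G ⧸ Subgroup.normalClosure (graphProductRelators Γ G)

/-!
The diagram product is the fundamental group of a complex of groups over the component of the
Squier complex that consists of the 1-paths parallel to the base `p`. This component is connected
because parallel 1-paths are homotopic, and simply connected because the diagram group is trivial.
Hence the fundamental group is the colimit of the groups `G(s)` along the edge groups
(`ComplexOfGroups.nonempty_pi1_mulEquiv`): there are canonical morphisms from the base to all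
vertices, which transport the vertex groups to the base, and the homomorphisms obtained in this way
agree on the edge groups.

The graph product is this colimit too. A nonempty 1-path is never homotopic to an empty one, so
there are no directed cycles and the edges of a 1-path `s` are pairwise different. They are
therefore pairwise adjacent in the independence graph, and multiplication of coordinates is a
homomorphism from `G(s)` to the graph product (`DirectedTwoComplex.pathGroupToGraphProduct`),
compatible with the edge groups. Conversely, let compatible homomorphisms `ψ s` from the groups
`G(s)` to a group be given. For an edge `e` and 1-paths `l e r` and `l' e r'`, the 1-paths `l`, `l'`
are homotopic, and so are `r`, `r'`; all the edges of the Squier complex passed when `l` is changed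
to `l'` and then `r` to `r'` have `G e` as a factor of their groups, so the restriction of `ψ s`
to `G e` does not depend on `s` (`DirectedTwoComplex.map_single_eq`). The resulting homomorphisms on
the groups `G e` commute for adjacent edges, which lie on a common 1-path, and so they extend to the
graph product (`DirectedTwoComplex.exists_extension`).
-/

/-! ### Fundamental groupoids of complexes of groups -/

/-- Induction principle for the morphisms of a free groupoid. -/
theorem Quiver.FreeGroupoid.hom_induction {V : Type u} [Quiver.{v} V]
    {P : ∀ {a b : Quiver.FreeGroupoid V}, (a ⟶ b) → Prop}
    (id : ∀ a, P (𝟙 a))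
    (of : ∀ {a b : V} (e : a ⟶ b), P ((Quiver.FreeGroupoid.of V).map e))
    (inv : ∀ {a b : Quiver.FreeGroupoid V} (f : a ⟶ b), P f → P (Groupoid.inv f))
    (comp : ∀ {a b c : Quiver.FreeGroupoid V} (f : a ⟶ b) (g : b ⟶ c), P f → P g → P (f ≫ g))
    {a b : Quiver.FreeGroupoid V} (f : a ⟶ b) : P f := by
  obtain ⟨a⟩ := a
  obtain ⟨b⟩ := b
  obtain ⟨f⟩ := f
  have key : ∀ {c : Quiver.Symmetrify V} (q : Quiver.Path (V := Quiver.Symmetrify V) a c),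
      P (a := ⟨a⟩) (b := ⟨c⟩) (Quot.mk _ q) := by
    intro c q
    induction q with
    | nil => exact id ⟨a⟩
    | cons q e ih =>
      rcases e with e | e
      · exact comp (b := ⟨_⟩) (Quot.mk _ q) _ ih (of e)
      · exact comp (b := ⟨_⟩) (Quot.mk _ q) _ ih (inv _ (of e))
  exact key f

namespace ComplexOfGroups

variable {X : Type u} [Quiver.{v} X] (C : ComplexOfGroups.{u, v, w} X)

/-- The class of an element of a vertex group in the fundamental groupoid. -/
def eltHom {a : X} (g : C.VertexGroup a) : C.obj a ⟶ C.obj a :=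
  (CategoryTheory.Quotient.functor C.Rel).map (C.elt g)

/-- The class of an edge in the fundamental groupoid. -/
def edgeHom {a b : X} (e : a ⟶ b) : C.obj a ⟶ C.obj b :=
  (CategoryTheory.Quotient.functor C.Rel).map (C.edge e)

theorem eltHom_mul {a : X} (g h : C.VertexGroup a) :
    C.eltHom (g * h) = C.eltHom g ≫ C.eltHom h :=
  (CategoryTheory.Quotient.sound C.Rel (Rel.mul g h)).symm

theorem eltHom_comp_edgeHom {a b : X} (e : a ⟶ b) (k : C.EdgeGroup e) :
    C.eltHom (C.ι e k) ≫ C.edgeHom e = C.edgeHom e ≫ C.eltHom (C.τ e k) :=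
  CategoryTheory.Quotient.sound C.Rel (Rel.edge e k)

/-- Induction principle for the morphisms of the fundamental groupoid. -/
theorem hom_induction {P : ∀ {a b : X}, (C.obj a ⟶ C.obj b) → Prop}
    (id : ∀ a, P (𝟙 (C.obj a)))
    (elt : ∀ {a : X} (g : C.VertexGroup a), P (C.eltHom g))
    (edge : ∀ {a b : X} (e : a ⟶ b), P (C.edgeHom e))
    (inv : ∀ {a b : X} (f : C.obj a ⟶ C.obj b), P f → P (CategoryTheory.Groupoid.inv f))
    (comp : ∀ {a b c : X} (f : C.obj a ⟶ C.obj b) (g : C.obj b ⟶ C.obj c),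
      P f → P g → P (f ≫ g))
    {a b : X} (f : C.obj a ⟶ C.obj b) : P f := by
  obtain ⟨f⟩ := f
  refine Quiver.FreeGroupoid.hom_induction (V := C.Vertex)
    (P := fun {a b} f => P (a := a.as) (b := b.as) ((CategoryTheory.Quotient.functor C.Rel).map f))
    ?_ ?_ ?_ ?_ f
  · exact fun a => id a.as
  · rintro a b (g | e)
    · exact elt g
    · exact edge e
  · exact fun f hf => inv _ hf
  · exact fun f g hf hg => comp _ _ hf hg

/-- The functor from the fundamental groupoid of the underlying square complex to that of the
complex of groups. -/
noncomputable def ofCells : C.cells.Groupoid ⥤ C.Groupoid :=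
  CategoryTheory.Quotient.lift _
    (Quiver.FreeGroupoid.lift
      { obj := fun a => C.obj a
        map := fun e => C.edgeHom e })
    (by
      rintro _ _ _ _ ⟨e₁, e₂, e₁', e₂', h⟩
      exact CategoryTheory.Quotient.sound C.Rel (Rel.square e₁ e₂ e₁' e₂' h))

/-- The class of an edge in the fundamental groupoid of the underlying square complex. -/
def cellsEdgeHom {a b : X} (e : a ⟶ b) : C.cells.obj a ⟶ C.cells.obj b :=
  (CategoryTheory.Quotient.functor C.cells.Rel).map ((Quiver.FreeGroupoid.of X).map e)

/-- The action of `ofCells` on morphisms. -/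
noncomputable def cellsMap {a b : X} (h : C.cells.obj a ⟶ C.cells.obj b) : C.obj a ⟶ C.obj b :=
  C.ofCells.map h

theorem cellsMap_id (a : X) : C.cellsMap (𝟙 (C.cells.obj a)) = 𝟙 (C.obj a) :=
  C.ofCells.map_id _

theorem cellsMap_comp {a b c : X} (h : C.cells.obj a ⟶ C.cells.obj b)
    (k : C.cells.obj b ⟶ C.cells.obj c) : C.cellsMap (h ≫ k) = C.cellsMap h ≫ C.cellsMap k :=
  C.ofCells.map_comp h k

theorem cellsMap_cellsEdgeHom {a b : X} (e : a ⟶ b) :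
    C.cellsMap (C.cellsEdgeHom e) = C.edgeHom e :=
  Category.id_comp (C.edgeHom e)

section Lift

variable {C} {H : Type x} [Group H] (φ : ∀ a, C.VertexGroup a →* H)
  (hφ : ∀ {a b : X} (e : a ⟶ b) (k : C.EdgeGroup e), φ a (C.ι e k) = φ b (C.τ e k))

/-- The functor to a group `H` that is given by compatible homomorphisms `φ` on the vertex groups
and sends all edges to `1`. The opposite group occurs because composition in `SingleObj` is
multiplication in the reverse order. -/
noncomputable def liftFunctor : C.Groupoid ⥤ SingleObj Hᵐᵒᵖ :=
  CategoryTheory.Quotient.lift _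
    (Quiver.FreeGroupoid.lift (V := C.Vertex)
      { obj := fun _ => SingleObj.star _
        map := fun {a _} e => match e with
          | Gen.elt g => MulOpposite.op (φ _ g)
          | Gen.edge _ => (1 : Hᵐᵒᵖ) })
    (by
      have h1 : ∀ z : Hᵐᵒᵖ, z * 1 = z := mul_one
      rintro _ _ _ _ (⟨g, h⟩ | ⟨e, k⟩ | ⟨e₁, e₂, e₁', e₂', h⟩)
      · rw [Functor.map_comp]
        change (MulOpposite.op (φ _ h) * 1) * (MulOpposite.op (φ _ g) * 1) =
          MulOpposite.op (φ _ (g * h)) * 1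
        rw [h1, h1, h1, map_mul, MulOpposite.op_mul]
      · rw [Functor.map_comp, Functor.map_comp]
        change ((1 : Hᵐᵒᵖ) * 1) * (MulOpposite.op (φ _ (C.ι e k)) * 1) =
          (MulOpposite.op (φ _ (C.τ e k)) * 1) * (1 * 1)
        rw [hφ]
        simp
      · rw [Functor.map_comp, Functor.map_comp]
        rfl)

/-- The value of `liftFunctor` on a morphism, as an element of `H`. -/
noncomputable def lift {a b : X} (f : C.obj a ⟶ C.obj b) : H :=
  MulOpposite.unop ((liftFunctor φ hφ).map f)

theorem lift_id (a : X) : lift φ hφ (𝟙 (C.obj a)) = 1 :=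
  congrArg MulOpposite.unop ((liftFunctor φ hφ).map_id _)

theorem lift_comp {a b c : X} (f : C.obj a ⟶ C.obj b) (g : C.obj b ⟶ C.obj c) :
    lift φ hφ (f ≫ g) = lift φ hφ f * lift φ hφ g :=
  congrArg MulOpposite.unop ((liftFunctor φ hφ).map_comp _ _)

theorem lift_inv {a b : X} (f : C.obj a ⟶ C.obj b) :
    lift φ hφ (CategoryTheory.Groupoid.inv f) = (lift φ hφ f)⁻¹ := by
  refine eq_inv_of_mul_eq_one_left ?_
  rw [← lift_comp, CategoryTheory.Groupoid.inv_comp, lift_id]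

theorem lift_eltHom {a : X} (g : C.VertexGroup a) : lift φ hφ (C.eltHom g) = φ a g :=
  congrArg MulOpposite.unop (mul_one (MulOpposite.op (φ a g)))

theorem lift_edgeHom {a b : X} (e : a ⟶ b) : lift φ hφ (C.edgeHom e) = 1 :=
  congrArg MulOpposite.unop (mul_one (1 : Hᵐᵒᵖ))

end Lift

/-- Conjugation by `u : a ⟶ b` as a homomorphism from the group of the vertex `b` to the
fundamental group at `a`. -/
noncomputable def conjElt {a b : X} (u : C.obj a ⟶ C.obj b) : C.VertexGroup b →* C.Pi1 a :=
  MonoidHom.mk' (fun g => u ≫ C.eltHom g ≫ CategoryTheory.Groupoid.inv u) (fun g h => by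
    change _ = (u ≫ C.eltHom g ≫ CategoryTheory.Groupoid.inv u) ≫
      (u ≫ C.eltHom h ≫ CategoryTheory.Groupoid.inv u)
    rw [eltHom_mul]
    simp)

/-- If the underlying square complex is connected and simply connected, then the fundamental group
of a complex of groups is the colimit of the vertex groups along the edge groups: it is isomorphic
to every group `H` that is generated by compatible images of the vertex groups and to which
compatible homomorphisms from the vertex groups extend. -/
theorem nonempty_pi1_mulEquiv {a : X} (hsc : Subsingleton (C.cells.Pi1 a))
    (hconn : ∀ b, Relation.EqvGen (fun s t : X => Nonempty (s ⟶ t)) a b)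
    {H : Type x} [Group H] (φ : ∀ b, C.VertexGroup b →* H)
    (hφ : ∀ {b c : X} (e : b ⟶ c) (k : C.EdgeGroup e), φ b (C.ι e k) = φ c (C.τ e k))
    (hgen : ∀ L : Subgroup H, (∀ b g, φ b g ∈ L) → L = ⊤)
    (hext : ∀ ψ : ∀ b, C.VertexGroup b →* C.Pi1 a,
      (∀ {b c : X} (e : b ⟶ c) (k : C.EdgeGroup e), ψ b (C.ι e k) = ψ c (C.τ e k)) →
      ∃ Ψ : H →* C.Pi1 a, ∀ b g, Ψ (φ b g) = ψ b g) :
    Nonempty (C.Pi1 a ≃* H) := by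
  -- The morphism between two vertices is found together with the fact that it is killed by
  -- `lift φ`, which makes conjugation by it invisible in `H`.
  have hpath : ∀ b c, Relation.EqvGen (fun s t : X => Nonempty (s ⟶ t)) b c →
      ∃ h : C.cells.obj b ⟶ C.cells.obj c, lift φ hφ (C.cellsMap h) = 1 := by
    intro b c hbc
    induction hbc with
    | rel b c e =>
      obtain ⟨e⟩ := e
      exact ⟨C.cellsEdgeHom e, by rw [cellsMap_cellsEdgeHom, lift_edgeHom]⟩
    | refl b => exact ⟨𝟙 _, by rw [cellsMap_id, lift_id]⟩
    | symm b c _ ih =>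
      obtain ⟨h, hh⟩ := ih
      refine ⟨CategoryTheory.Groupoid.inv h, ?_⟩
      have h2 := lift_comp φ hφ (C.cellsMap h) (C.cellsMap (CategoryTheory.Groupoid.inv h))
      rw [← cellsMap_comp, CategoryTheory.Groupoid.comp_inv, cellsMap_id, lift_id, hh,
        one_mul] at h2
      exact h2.symm
    | trans b c d _ _ ih₁ ih₂ =>
      obtain ⟨h₁, hh₁⟩ := ih₁
      obtain ⟨h₂, hh₂⟩ := ih₂
      refine ⟨h₁ ≫ h₂, ?_⟩
      rw [cellsMap_comp, lift_comp, hh₁, hh₂, one_mul]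
  choose h hh using fun b => hpath a b (hconn b)
  let u : ∀ b, C.obj a ⟶ C.obj b := fun b => C.cellsMap (h b)
  -- Simple connectedness makes the chosen morphisms `u b` compatible with all edges.
  have hu : ∀ {b c : X} (e : b ⟶ c), u b ≫ C.edgeHom e = u c := by
    intro b c e
    have h1 : h b ≫ C.cellsEdgeHom e ≫ CategoryTheory.Groupoid.inv (h c) = 𝟙 _ :=
      Subsingleton.elim _ _
    have h2 : h b ≫ C.cellsEdgeHom e = h c := by
      have := congrArg (· ≫ h c) h1
      simpa using this
    change C.cellsMap (h b) ≫ C.edgeHom e = C.cellsMap (h c)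
    rw [← h2, cellsMap_comp, cellsMap_cellsEdgeHom]
  have hua : u a = 𝟙 _ := by
    have : h a = 𝟙 _ := Subsingleton.elim _ _
    change C.cellsMap (h a) = _
    rw [this, cellsMap_id]
  have hψ : ∀ {b c : X} (e : b ⟶ c) (k : C.EdgeGroup e),
      C.conjElt (u b) (C.ι e k) = C.conjElt (u c) (C.τ e k) := by
    intro b c e k
    change u b ≫ C.eltHom (C.ι e k) ≫ CategoryTheory.Groupoid.inv (u b) =
      u c ≫ C.eltHom (C.τ e k) ≫ CategoryTheory.Groupoid.inv (u c)
    rw [← hu e, Category.assoc, ← Category.assoc (C.edgeHom e), ← eltHom_comp_edgeHom]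
    simp
  obtain ⟨Ψ, hΨ⟩ := hext (fun b => C.conjElt (u b)) hψ
  let Φ : C.Pi1 a →* H := MonoidHom.mk' (fun f => lift φ hφ f) (fun f g => lift_comp φ hφ f g)
  have hΦΨ : Φ.comp Ψ = MonoidHom.id H := by
    have htop := hgen ((Φ.comp Ψ).eqLocus (MonoidHom.id H)) (fun b g => by
      change Φ (Ψ (φ b g)) = φ b g
      rw [hΨ]
      change lift φ hφ (u b ≫ C.eltHom g ≫ CategoryTheory.Groupoid.inv (u b)) = _
      have hub : lift φ hφ (u b) = 1 := hh b
      rw [lift_comp, lift_comp, lift_inv, hub, lift_eltHom]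
      simp)
    ext z
    exact (htop ▸ Subgroup.mem_top z : z ∈ (Φ.comp Ψ).eqLocus (MonoidHom.id H))
  have hΨΦ : ∀ {b c : X} (f : C.obj b ⟶ C.obj c),
      (Ψ (lift φ hφ f) : C.obj a ⟶ C.obj a) = u b ≫ f ≫ CategoryTheory.Groupoid.inv (u c) := by
    intro b c f
    induction f using C.hom_induction with
    | id b =>
      rw [lift_id, map_one]
      simp
    | elt g => rw [lift_eltHom, hΨ]; rfl
    | edge e =>
      rw [lift_edgeHom, map_one, ← Category.assoc, hu, CategoryTheory.Groupoid.comp_inv]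
      rfl
    | inv f ih =>
      rw [lift_inv, map_inv, ih]
      change CategoryTheory.Groupoid.inv _ = _
      simp
    | comp f g ihf ihg =>
      rw [lift_comp, map_mul, ihf, ihg]
      change (_ ≫ _ ≫ _) ≫ (_ ≫ _ ≫ _) = _
      simp
  refine ⟨MonoidHom.toMulEquiv Φ Ψ ?_ hΦΨ⟩
  ext f
  change Ψ (lift φ hφ f) = f
  rw [hΨΦ, hua]
  simp

end ComplexOfGroups

namespace DirectedTwoComplex

variable {V : Type u} [Quiver.{v} V] (K : DirectedTwoComplex.{u, v, w} V)

/-! ### Absence of directed cycles -/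

theorem Homotopic.length_eq_zero_iff {K : DirectedTwoComplex.{u, v, w} V} {a b : V}
    {s t : Quiver.Path a b} (h : K.Homotopic s t) : s.length = 0 ↔ t.length = 0 := by
  induction h with
  | rel s t e =>
    obtain ⟨f, l, r, rfl, rfl⟩ := e
    have h₁ := K.top_nonempty f
    have h₂ := K.bot_nonempty f
    simp only [Quiver.Path.length_comp]
    omega
  | refl s => exact Iff.rfl
  | symm s t _ ih => exact ih.symm
  | trans s t r _ _ ih₁ ih₂ => exact ih₁.trans ih₂

/-- If 1-paths with common endpoints are homotopic, then there are no directed cycles, since a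
nonempty 1-path is never homotopic to an empty one; so no edge occurs twice in a 1-path. -/
theorem ne_of_occurs_of_homotopic
    (hT2 : ∀ (a b : V) (s t : Quiver.Path a b), K.Homotopic s t) {a c d : V}
    {s : Quiver.Path a c} (e : c ⟶ d) {e' : K.Edge} (h : K.Occurs e' s) :
    e' ≠ ⟨c, d, e⟩ := by
  rintro rfl
  obtain ⟨p, q, -⟩ := h
  have := (hT2 d d (q.cons e) Quiver.Path.nil).length_eq_zero_iff
  simp at this

variable {K} in
theorem Occurs.comp {e : K.Edge} {a b c : V} {s : Quiver.Path a b} (h : K.Occurs e s)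
    (r : Quiver.Path b c) : K.Occurs e (s.comp r) := by
  obtain ⟨p, q, rfl⟩ := h
  exact ⟨p, q.comp r, by simp⟩

theorem occurs_cons_comp {a b c d : V} (l : Quiver.Path a c) (e : c ⟶ d)
    (r : Quiver.Path d b) : K.Occurs ⟨c, d, e⟩ ((l.cons e).comp r) :=
  ⟨l, r, rfl⟩

/-! ### Products of the coordinates of a tuple -/

section PathProd

variable {G : K.Edge → Type x} [∀ e, Group (G e)] {L : Type*} [Group L] (γ : ∀ e, G e →* L)

/-- The product in `L`, in the order of the edges, of the images under `γ` of the coordinates of a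
tuple in `G(s)`. -/
def pathProd {a : V} : ∀ {b : V} (s : Quiver.Path a b), K.PathGroup G s → L
  | _, .nil, _ => 1
  | _, .cons p e, g => pathProd p g.1 * γ ⟨_, _, e⟩ g.2

theorem pathProd_one {a b : V} (s : Quiver.Path a b) : K.pathProd γ s 1 = 1 := by
  induction s with
  | nil => rfl
  | cons p e ih =>
    change K.pathProd γ p 1 * γ ⟨_, _, e⟩ 1 = 1
    rw [ih, map_one, one_mul]

theorem pathProd_concat {a b c : V} (p : Quiver.Path a b) (q : Quiver.Path b c)
    (x : K.PathGroup G p) (y : K.PathGroup G q) :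
    K.pathProd γ (p.comp q) (K.concat G p q (x, y)) = K.pathProd γ p x * K.pathProd γ q y := by
  induction q with
  | nil => exact (mul_one _).symm
  | cons q e ih =>
    change K.pathProd γ (p.comp q) (K.concat G p q (x, y.1)) * γ ⟨_, _, e⟩ y.2 =
      K.pathProd γ p x * (K.pathProd γ q y.1 * γ ⟨_, _, e⟩ y.2)
    rw [ih, mul_assoc]

theorem pathProd_embed {a b c d : V} (p : Quiver.Path a b) (r : Quiver.Path b c)
    (q : Quiver.Path c d) (k : K.PathGroup G p × K.PathGroup G q) :
    K.pathProd γ _ (K.embed G p r q k) = K.pathProd γ p k.1 * K.pathProd γ q k.2 := by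
  change K.pathProd γ _ (K.concat G (p.comp r) q (K.concat G p r (k.1, 1), k.2)) = _
  rw [pathProd_concat, pathProd_concat, pathProd_one, mul_one]

theorem pathProd_edgeι_eq_edgeτ {a b : V} {s t : Quiver.Path a b} (e : K.SquierEdge s t)
    (k : K.PathGroup G e.left × K.PathGroup G e.right) :
    K.pathProd γ s (K.edgeι G e k) = K.pathProd γ t (K.edgeτ G e k) := by
  obtain ⟨f, l, r, rfl, rfl⟩ := e
  exact (K.pathProd_embed γ _ _ _ _).trans (K.pathProd_embed γ _ _ _ _).symm

theorem commute_pathProd {a b : V} (s : Quiver.Path a b) (z : L)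
    (h : ∀ e, K.Occurs e s → ∀ y, Commute (γ e y) z) (g : K.PathGroup G s) :
    Commute (K.pathProd γ s g) z := by
  induction s with
  | nil => exact Commute.one_left z
  | cons p e ih =>
    refine Commute.mul_left (ih (fun e' he' y => ?_) g.1) (h _ (K.occurs_cons_comp p e .nil) g.2)
    exact h e' (he'.comp e.toPath) y

theorem pathProd_mul {a b : V} (s : Quiver.Path a b)
    (h : ∀ {c d : V} (p : Quiver.Path a c) (e : c ⟶ d) (q : Quiver.Path d b),
      s = (p.cons e).comp q → ∀ e', K.Occurs e' p → ∀ x y, Commute (γ e' x) (γ ⟨c, d, e⟩ y))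
    (g₁ g₂ : K.PathGroup G s) :
    K.pathProd γ s (g₁ * g₂) = K.pathProd γ s g₁ * K.pathProd γ s g₂ := by
  induction s with
  | nil => exact (mul_one _).symm
  | cons p e ih =>
    have hc : Commute (K.pathProd γ p g₂.1) (γ ⟨_, _, e⟩ g₁.2) :=
      K.commute_pathProd γ p _ (fun e' he' y => h p e .nil rfl e' he' y _) _
    change K.pathProd γ p (g₁.1 * g₂.1) * γ ⟨_, _, e⟩ (g₁.2 * g₂.2) =
      (K.pathProd γ p g₁.1 * γ ⟨_, _, e⟩ g₁.2) * (K.pathProd γ p g₂.1 * γ ⟨_, _, e⟩ g₂.2)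
    rw [ih (fun p' e' q hq => h p' e' (q.cons e) (by rw [hq]; rfl)), map_mul]
    rw [mul_assoc, mul_assoc, ← mul_assoc _ _ (γ ⟨_, _, e⟩ g₂.2), hc.eq, mul_assoc]

end PathProd

/-! ### Tuples with one nontrivial coordinate -/

section Single

variable (G : K.Edge → Type x) [∀ e, Group (G e)]

/-- The embedding of `G e` in `G(l e)` as the last coordinate. -/
def lastCoord {a c d : V} (l : Quiver.Path a c) (e : c ⟶ d) :
    G ⟨c, d, e⟩ →* K.PathGroup G (l.cons e) where
  toFun g := (1, g)
  map_one' := rfl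
  map_mul' _ _ := Prod.ext (one_mul 1).symm rfl

/-- The coordinate-wise embedding of `G e` in `G(l e r)`. -/
def single {a b c d : V} (l : Quiver.Path a c) (e : c ⟶ d) (r : Quiver.Path d b) :
    G ⟨c, d, e⟩ →* K.PathGroup G ((l.cons e).comp r) :=
  (K.concat G (l.cons e) r).toMonoidHom.comp
    ((MonoidHom.inl _ _).comp (K.lastCoord G l e))

theorem single_apply {a b c d : V} (l : Quiver.Path a c) (e : c ⟶ d) (r : Quiver.Path d b)
    (g : G ⟨c, d, e⟩) :
    K.single G l e r g = K.concat G (l.cons e) r (K.lastCoord G l e g, 1) :=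
  rfl

theorem concat_one {a b c : V} (p : Quiver.Path a b) (q : Quiver.Path b c) :
    K.concat G p q (1, 1) = 1 :=
  map_one (K.concat G p q)

theorem concat_one_lastCoord {a b c d : V} (p : Quiver.Path a b) (q : Quiver.Path b c)
    (e : c ⟶ d) (g : G ⟨c, d, e⟩) :
    K.concat G p (q.cons e) (1, K.lastCoord G q e g) = K.lastCoord G (p.comp q) e g :=
  Prod.ext (K.concat_one G p q) rfl

variable {G} in
theorem pathProd_single {L : Type*} [Group L] (γ : ∀ e, G e →* L) {a b c d : V}
    (l : Quiver.Path a c) (e : c ⟶ d) (r : Quiver.Path d b) (g : G ⟨c, d, e⟩) :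
    K.pathProd γ _ (K.single G l e r g) = γ ⟨c, d, e⟩ g := by
  rw [single_apply, pathProd_concat, pathProd_one, mul_one]
  change K.pathProd γ l 1 * γ ⟨c, d, e⟩ g = _
  rw [pathProd_one, one_mul]

theorem pathGroupCongr_cons {a b c : V} {s t : Quiver.Path a b} (h : s = t) (e : b ⟶ c)
    (h' : s.cons e = t.cons e) (x : K.PathGroup G s) (y : G ⟨b, c, e⟩) :
    K.pathGroupCongr G h' (x, y) = (K.pathGroupCongr G h x, y) := by
  subst h
  rfl

theorem pathGroupCongr_concat_assoc {a b c d : V} (p : Quiver.Path a b) (q : Quiver.Path b c)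
    (r : Quiver.Path c d) (h : (p.comp q).comp r = p.comp (q.comp r)) (x : K.PathGroup G p)
    (y : K.PathGroup G q) (z : K.PathGroup G r) :
    K.pathGroupCongr G h (K.concat G (p.comp q) r (K.concat G p q (x, y), z)) =
      K.concat G p (q.comp r) (x, K.concat G q r (y, z)) := by
  induction r with
  | nil => rfl
  | cons r e ih =>
    refine (K.pathGroupCongr_cons G (Quiver.Path.comp_assoc p q r) e h _ _).trans ?_
    rw [ih]
    rfl

/-- Coordinates at different edges commute. The two occurrences are compared from the end of the
1-path. -/
theorem commute_single {a b c₁ d₁ c₂ d₂ : V} (l₁ : Quiver.Path a c₁) (e₁ : c₁ ⟶ d₁)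
    (r₁ : Quiver.Path d₁ b) (l₂ : Quiver.Path a c₂) (e₂ : c₂ ⟶ d₂) (r₂ : Quiver.Path d₂ b)
    (hne : (⟨c₁, d₁, e₁⟩ : K.Edge) ≠ ⟨c₂, d₂, e₂⟩)
    (h : (l₁.cons e₁).comp r₁ = (l₂.cons e₂).comp r₂)
    (g₁ : G ⟨c₁, d₁, e₁⟩) (g₂ : G ⟨c₂, d₂, e₂⟩) :
    Commute (K.pathGroupCongr G h (K.single G l₁ e₁ r₁ g₁)) (K.single G l₂ e₂ r₂ g₂) := by
  induction r₁ with
  | nil =>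
    cases r₂ with
    | nil =>
      cases h
      exact absurd rfl hne
    | cons r₂ e =>
      cases h
      exact Prod.ext ((one_mul _).trans (mul_one _).symm) ((mul_one _).trans (one_mul _).symm)
  | cons r₁ e ih =>
    cases r₂ with
    | nil =>
      cases h
      exact Prod.ext ((mul_one _).trans (one_mul _).symm) ((one_mul _).trans (mul_one _).symm)
    | cons r₂ e' =>
      obtain rfl := Quiver.Path.obj_eq_of_cons_eq_cons h
      obtain rfl := eq_of_heq (Quiver.Path.hom_heq_of_cons_eq_cons h)
      have h' := eq_of_heq (Quiver.Path.heq_of_cons_eq_cons h)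
      have hi := ih r₂ h'
      have h₁ : K.pathGroupCongr G h (K.single G l₁ e₁ (r₁.cons e) g₁) =
          (K.pathGroupCongr G h' (K.single G l₁ e₁ r₁ g₁), 1) :=
        K.pathGroupCongr_cons G h' e h _ _
      rw [h₁]
      exact Prod.ext hi rfl

end Single

/-! ### Compatible families of homomorphisms on the vertex groups -/

section Compatible

variable {K} {G : K.Edge → Type x} [∀ e, Group (G e)] {L : Type*} [Group L] {a b : V}
  (ψ : ∀ s : Quiver.Path a b, K.PathGroup G s →* L)

theorem map_pathGroupCongr {s t : Quiver.Path a b} (h : s = t) (y : K.PathGroup G s) :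
    ψ t (K.pathGroupCongr G h y) = ψ s y := by
  subst h
  rfl

theorem map_concat_assoc {c d : V} (p : Quiver.Path a c) (q : Quiver.Path c d)
    (r : Quiver.Path d b) (x : K.PathGroup G p) (y : K.PathGroup G q) (z : K.PathGroup G r) :
    ψ _ (K.concat G p (q.comp r) (x, K.concat G q r (y, z))) =
      ψ _ (K.concat G (p.comp q) r (K.concat G p q (x, y), z)) := by
  rw [← K.pathGroupCongr_concat_assoc G p q r (Quiver.Path.comp_assoc p q r),
    map_pathGroupCongr]

theorem map_single_congr_right {c d : V} (l : Quiver.Path a c) (e : c ⟶ d)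
    {r r' : Quiver.Path d b} (h : r = r') (g : G ⟨c, d, e⟩) :
    ψ _ (K.single G l e r g) = ψ _ (K.single G l e r' g) := by
  subst h
  rfl

theorem map_embed_one_single {c d y z : V} (p : Quiver.Path a y) (m : Quiver.Path y z)
    (q : Quiver.Path z c) (e : c ⟶ d) (r : Quiver.Path d b) (g : G ⟨c, d, e⟩) :
    ψ _ (K.embed G p m ((q.cons e).comp r) (1, K.single G q e r g)) =
      ψ _ (K.single G ((p.comp m).comp q) e r g) := by
  change ψ _ (K.concat G (p.comp m) ((q.cons e).comp r) (K.concat G p m (1, 1),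
    K.concat G (q.cons e) r (K.lastCoord G q e g, 1))) = _
  rw [map_concat_assoc, concat_one, concat_one_lastCoord]
  rfl

theorem map_embed_single_one {c d y z : V} (l : Quiver.Path a c) (e : c ⟶ d)
    (p : Quiver.Path d y) (m : Quiver.Path y z) (q : Quiver.Path z b) (g : G ⟨c, d, e⟩) :
    ψ _ (K.embed G ((l.cons e).comp p) m q (K.single G l e p g, 1)) =
      ψ _ (K.single G l e ((p.comp m).comp q) g) := by
  change ψ _ (K.concat G (((l.cons e).comp p).comp m) q
    (K.concat G ((l.cons e).comp p) m (K.concat G (l.cons e) p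
      (K.lastCoord G l e g, 1), 1), 1)) = _
  rw [← map_concat_assoc, ← map_concat_assoc, concat_one, concat_one, ← single_apply,
    map_single_congr_right ψ l e (Quiver.Path.comp_assoc p m q) g]

variable (hψ : ∀ {s t : Quiver.Path a b} (e : K.SquierEdge s t)
  (k : K.PathGroup G e.left × K.PathGroup G e.right),
  ψ s (K.edgeι G e k) = ψ t (K.edgeτ G e k))

include hψ

theorem map_single_eq_of_homotopic_left {c d : V} {l l' : Quiver.Path a c}
    (h : K.Homotopic l l') (e : c ⟶ d) (r : Quiver.Path d b) (g : G ⟨c, d, e⟩) :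
    ψ _ (K.single G l e r g) = ψ _ (K.single G l' e r g) := by
  induction h with
  | rel l l' ε =>
    obtain ⟨f, p, q, rfl, rfl⟩ := ε
    have := hψ (SquierEdge.mk (s := ((((p.comp (K.top f)).comp q).cons e).comp r))
      (t := ((((p.comp (K.bot f)).comp q).cons e).comp r)) f p ((q.cons e).comp r)
      (Quiver.Path.comp_assoc (p.comp (K.top f)) (q.cons e) r).symm
      (Quiver.Path.comp_assoc (p.comp (K.bot f)) (q.cons e) r).symm) (1, K.single G q e r g)
    refine Eq.trans ?_ (this.trans ?_)
    · exact ((map_pathGroupCongr ψ _ _).trans (map_embed_one_single ψ p _ q e r g)).symm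
    · exact (map_pathGroupCongr ψ _ _).trans (map_embed_one_single ψ p _ q e r g)
  | refl l => rfl
  | symm l l' _ ih => exact ih.symm
  | trans l l' l'' _ _ ih₁ ih₂ => exact ih₁.trans ih₂

theorem map_single_eq_of_homotopic_right {c d : V} (l : Quiver.Path a c) (e : c ⟶ d)
    {r r' : Quiver.Path d b} (h : K.Homotopic r r') (g : G ⟨c, d, e⟩) :
    ψ _ (K.single G l e r g) = ψ _ (K.single G l e r' g) := by
  induction h with
  | rel r r' ε =>
    obtain ⟨f, p, q, rfl, rfl⟩ := ε
    have := hψ (SquierEdge.mk (s := (l.cons e).comp ((p.comp (K.top f)).comp q))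
      (t := (l.cons e).comp ((p.comp (K.bot f)).comp q)) f ((l.cons e).comp p) q
      (by simp only [Quiver.Path.comp_assoc]) (by simp only [Quiver.Path.comp_assoc]))
      (K.single G l e p g, 1)
    refine Eq.trans ?_ (this.trans ?_)
    · exact ((map_pathGroupCongr ψ _ _).trans (map_embed_single_one ψ l e p _ q g)).symm
    · exact (map_pathGroupCongr ψ _ _).trans (map_embed_single_one ψ l e p _ q g)
  | refl l => rfl
  | symm l l' _ ih => exact ih.symm
  | trans l l' l'' _ _ ih₁ ih₂ => exact ih₁.trans ih₂

/-- The image of an element of `G e` does not depend on the 1-path through `e` in whose group the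
element is placed: the parts before and after `e` can be homotoped independently, and the edge
groups met on the way contain `G e`. -/
theorem map_single_eq (hT2 : ∀ (a b : V) (s t : Quiver.Path a b), K.Homotopic s t) {c d : V}
    (l l' : Quiver.Path a c) (e : c ⟶ d) (r r' : Quiver.Path d b) (g : G ⟨c, d, e⟩) :
    ψ _ (K.single G l e r g) = ψ _ (K.single G l' e r' g) :=
  (map_single_eq_of_homotopic_left ψ hψ (hT2 _ _ l l') e r g).trans
    (map_single_eq_of_homotopic_right ψ hψ l' e (hT2 _ _ r r') g)

end Compatible

end DirectedTwoComplex

/-! ### Graph products -/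

namespace GraphProduct

variable {I : Type u} {Γ : SimpleGraph I} {M : I → Type v} [∀ i, Group (M i)]

variable (Γ M) in
/-- The canonical homomorphism from a vertex group to the graph product. -/
def of (i : I) : M i →* GraphProduct Γ M :=
  (QuotientGroup.mk' _).comp Monoid.CoprodI.of

theorem commute_of {i j : I} (h : Γ.Adj i j) (x : M i) (y : M j) :
    Commute (of Γ M i x) (of Γ M j y) := by
  have hrel : (of Γ M i x)⁻¹ * (of Γ M j y)⁻¹ * of Γ M i x * of Γ M j y = 1 :=
    (QuotientGroup.eq_one_iff _).2 (Subgroup.subset_normalClosure ⟨i, j, h, x, y, rfl⟩)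
  rw [mul_assoc, ← mul_inv_rev, inv_mul_eq_one] at hrel
  exact hrel.symm

/-- Homomorphisms from the vertex groups whose images commute for adjacent vertices extend to the
graph product. -/
theorem exists_lift {L : Type*} [Group L] (ρ : ∀ i, M i →* L)
    (hρ : ∀ i j, Γ.Adj i j → ∀ x y, Commute (ρ i x) (ρ j y)) :
    ∃ Ψ : GraphProduct Γ M →* L, ∀ i x, Ψ (of Γ M i x) = ρ i x := by
  refine ⟨QuotientGroup.lift _ (Monoid.CoprodI.lift ρ) ?_, fun i x => ?_⟩
  · refine Subgroup.normalClosure_le_normal ?_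
    rintro _ ⟨i, j, hij, x, y, rfl⟩
    change Monoid.CoprodI.lift ρ _ = 1
    simp only [map_mul, map_inv, Monoid.CoprodI.lift_of]
    rw [mul_assoc, ← mul_inv_rev, inv_mul_eq_one]
    exact (hρ i j hij x y).symm
  · exact Monoid.CoprodI.lift_of ρ x

theorem eq_top_of_forall_of_mem (S : Subgroup (GraphProduct Γ M))
    (h : ∀ i x, of Γ M i x ∈ S) : S = ⊤ := by
  refine (Subgroup.eq_top_iff' S).2 fun z => ?_
  obtain ⟨z, rfl⟩ := QuotientGroup.mk'_surjective _ z
  induction z using Monoid.CoprodI.induction_on with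
  | one => rw [map_one]; exact S.one_mem
  | of i x => exact h i x
  | mul y z hy hz => rw [map_mul]; exact S.mul_mem hy hz

end GraphProduct

namespace DirectedTwoComplex

variable {V : Type u} [Quiver.{v} V] (K : DirectedTwoComplex.{u, v, w} V)

/-! ### The graph product over the independence graph as a colimit of the groups `G(s)` -/

section GraphProduct

variable (G : K.Edge → Type x) [∀ e, Group (G e)] {o₁ o₂ : V} (p : Quiver.Path o₁ o₂)

open Classical in
/-- The canonical homomorphism from `G e` to the graph product over the independence graph; it is
trivial by convention if the edge `e` is not a vertex of this graph. -/
noncomputable def toGraphProduct (e : K.Edge) :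
    G e →* GraphProduct (K.independenceGraph p) (fun e => G e.1) :=
  if h : ∃ t : Quiver.Path o₁ o₂, K.Homotopic p t ∧ K.Occurs e t then
    GraphProduct.of (K.independenceGraph p) (fun e => G e.1) ⟨e, h⟩
  else 1

theorem toGraphProduct_vertex (e : K.IndependenceVertex p) (g : G e.1) :
    K.toGraphProduct G p e.1 g =
      GraphProduct.of (K.independenceGraph p) (fun e => G e.1) e g := by
  rw [toGraphProduct, dif_pos e.2]

theorem commute_toGraphProduct {e₁ e₂ : K.IndependenceVertex p}
    (h : (K.independenceGraph p).Adj e₁ e₂) (g₁ : G e₁.1) (g₂ : G e₂.1) :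
    Commute (K.toGraphProduct G p e₁.1 g₁) (K.toGraphProduct G p e₂.1 g₂) := by
  rw [toGraphProduct_vertex, toGraphProduct_vertex]
  exact GraphProduct.commute_of (M := fun e : K.IndependenceVertex p => G e.1) h g₁ g₂

variable {L : Type*} [Group L] (hT2 : ∀ (a b : V) (s t : Quiver.Path a b), K.Homotopic s t)

include hT2

/-- The homomorphism from `G(s)` to the graph product that multiplies the coordinates. It is a
homomorphism because the edges of a 1-path are pairwise different, hence pairwise adjacent in the
independence graph. -/
noncomputable def pathGroupToGraphProduct (s : Quiver.Path o₁ o₂) :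
    K.PathGroup G s →* GraphProduct (K.independenceGraph p) (fun e => G e.1) :=
  MonoidHom.mk' (K.pathProd (K.toGraphProduct G p) s) (K.pathProd_mul _ s (by
    rintro c d l e r rfl e' he' x y
    have h₁ : K.Occurs e' ((l.cons e).comp r) :=
      (he'.comp e.toPath).comp r
    have h₂ := K.occurs_cons_comp l e r
    exact K.commute_toGraphProduct G p (e₁ := ⟨e', _, hT2 _ _ _ _, h₁⟩)
      (e₂ := ⟨⟨c, d, e⟩, _, hT2 _ _ _ _, h₂⟩)
      ⟨fun h => K.ne_of_occurs_of_homotopic hT2 e he' (congrArg Subtype.val h),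
        _, hT2 _ _ _ _, h₁, h₂⟩ x y))

theorem eq_top_of_pathGroupToGraphProduct_mem
    (S : Subgroup (GraphProduct (K.independenceGraph p) (fun e => G e.1)))
    (h : ∀ s g, K.pathGroupToGraphProduct G p hT2 s g ∈ S) : S = ⊤ := by
  refine GraphProduct.eq_top_of_forall_of_mem S fun e g => ?_
  rw [← toGraphProduct_vertex]
  obtain ⟨⟨c, d, e⟩, t, ht, l, r, rfl⟩ := e
  rw [← K.pathProd_single (K.toGraphProduct G p) l e r g]
  exact h _ _

/-- Compatible homomorphisms from the groups `G(s)` extend to the graph product: their restrictions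
to the groups `G e` are independent of `s`, and those to the groups of adjacent edges commute
because both groups lie in a common `G(s)`. -/
theorem exists_extension (ψ : ∀ s : Quiver.Path o₁ o₂, K.PathGroup G s →* L)
    (hψ : ∀ {s t : Quiver.Path o₁ o₂} (e : K.SquierEdge s t)
      (k : K.PathGroup G e.left × K.PathGroup G e.right),
      ψ s (K.edgeι G e k) = ψ t (K.edgeτ G e k)) :
    ∃ Ψ : GraphProduct (K.independenceGraph p) (fun e => G e.1) →* L,
      ∀ s g, Ψ (K.pathGroupToGraphProduct G p hT2 s g) = ψ s g := by
  have hρ : ∀ e : K.IndependenceVertex p, ∃ ρ : G e.1 →* L,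
      ∀ (l : Quiver.Path o₁ e.1.1) (r : Quiver.Path e.1.2.1 o₂) (g : G e.1),
        ψ _ (K.single G l e.1.2.2 r g) = ρ g := by
    rintro ⟨⟨c, d, e⟩, t, ht, l, r, rfl⟩
    exact ⟨(ψ _).comp (K.single G l e r), fun l' r' g =>
      map_single_eq ψ hψ hT2 l' l e r' r g⟩
  choose ρ hρ using hρ
  obtain ⟨Ψ, hΨ⟩ := GraphProduct.exists_lift (Γ := K.independenceGraph p) ρ (by
    rintro ⟨⟨c₁, d₁, e₁⟩, h₁⟩ ⟨⟨c₂, d₂, e₂⟩, h₂⟩ ⟨hne, t, -, ⟨l₁, r₁, rfl⟩, ⟨l₂, r₂, h⟩⟩ g₁ g₂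
    rw [← hρ _ l₁ r₁, ← hρ _ l₂ r₂, ← map_pathGroupCongr ψ h]
    exact (K.commute_single G l₁ e₁ r₁ l₂ e₂ r₂
      (fun he => hne (Subtype.ext he)) h g₁ g₂).map (ψ _))
  refine ⟨Ψ, ?_⟩
  -- The statement for a 1-path follows from its version for initial parts of the 1-path.
  suffices hpre : ∀ {c : V} (s : Quiver.Path o₁ c) (r : Quiver.Path c o₂) (g : K.PathGroup G s),
      Ψ (K.pathProd (K.toGraphProduct G p) s g) = ψ _ (K.concat G s r (g, 1)) from
    fun s g => hpre s .nil g
  intro c s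
  induction s with
  | nil =>
    intro r g
    exact (map_one Ψ).trans ((map_one (ψ _)).symm.trans
      (congrArg (ψ _) (K.concat_one G Quiver.Path.nil r).symm))
  | @cons c d s e ih =>
    intro r g
    obtain ⟨g, y⟩ := g
    change Ψ (K.pathProd (K.toGraphProduct G p) s g * K.toGraphProduct G p ⟨c, d, e⟩ y) = _
    have hv : ∃ t : Quiver.Path o₁ o₂, K.Homotopic p t ∧ K.Occurs ⟨c, d, e⟩ t :=
      ⟨_, hT2 _ _ _ _, K.occurs_cons_comp s e r⟩
    rw [map_mul, ih (e.toPath.comp r), K.toGraphProduct_vertex G p ⟨⟨c, d, e⟩, hv⟩ y, hΨ,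
      ← hρ _ s r]
    have h₁ : K.concat G e.toPath r (1, 1) = 1 := K.concat_one G _ _
    rw [← h₁, map_concat_assoc ψ s e.toPath r g 1 1, single_apply]
    refine (map_mul (ψ _) _ _).symm.trans (congrArg (ψ _) ?_)
    refine (map_mul (K.concat G (s.cons e) r) _ _).symm.trans
      (congrArg (K.concat G (s.cons e) r) ?_)
    exact Prod.ext (Prod.ext (mul_one g) (one_mul y)) (one_mul 1)

end GraphProduct

end DirectedTwoComplex

theorem lemma2p2 {V : Type u} [Quiver.{v} V] (K : DirectedTwoComplex.{u, v, w} V)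
    {o₁ o₂ : V} (p : Quiver.Path o₁ o₂) (hp : p.length ≠ 0)
    (hT2 : ∀ (a b : V) (s t : Quiver.Path a b), K.Homotopic s t)
    (hT3 : Subsingleton (K.DiagramGroup p))
    (G : K.Edge → Type x) [∀ e, Group (G e)] :
    Nonempty (K.DiagramProduct G p ≃*
      GraphProduct (K.independenceGraph p) (fun e => G e.1)) :=
  (K.squierComplexOfGroups G o₁ o₂).nonempty_pi1_mulEquiv (a := p) hT3 (hT2 _ _ p)
    (K.pathGroupToGraphProduct G p hT2)
    (K.pathProd_edgeι_eq_edgeτ (K.toGraphProduct G p))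
    (K.eq_top_of_pathGroupToGraphProduct_mem G p hT2)
    (K.exists_extension G p hT2)
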